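/- Let $K$ be a field of characteristic $0$ and let $q\in K^\times$ be not a root of unity. Let $U=U_q(\widehat{\mathfrak{sl}}_2)$ be the associative unital $K$-algebra generated by $x^\pm(l)$ $(l\in\mathbb Z)$, $\varphi(-m),\psi(m)$ $(m\ge 0)$ and an invertible central element $q^{c/2}$, with $\varphi(0)\psi(0)=\psi(0)\varphi(0)=1$ and, for the currents $x^\pm(z)=\sum_{l\in\mathbb Z} x^\pm(l)z^{-l}$, $\varphi(z)=\sum_{m\ge0}\varphi(-m)z^{m}$, $\psi(z)=\sum_{m\ge0}\psi(m)z^{-m}$, the relations $$\varphi(z)\varphi(w)=\varphi(w)\varphi(z),\qquad \psi(z)\psi(w)=\psi(w)\psi(z),\qquad \varphi(z)\psi(w)=\frac{g(\tfrac zw q^{-c})}{g(\tfrac zw q^{c})}\,\psi(w)\varphi(z),$$ $$\varphi(z)x^\pm(w)=g(\tfrac zw q^{\mp c/2})^{\pm1}x^\pm(w)\varphi(z),\qquad \psi(z)x^\pm(w)=g(\tfrac wz q^{\mp c/2})^{\mp1}x^\pm(w)\psi(z),$$ $$[x^+(z),x^-(w)]=\frac1{q-q^{-1}}\Big(\delta(\tfrac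 zw q^{-c})\psi(wq^{c/2})-\delta(\tfrac zw q^{c})\varphi(zq^{c/2})\Big),$$ $$(z-q^{\pm2}w)x^\pm(z)x^\pm(w)=(q^{\pm2}z-w)x^\pm(w)x^\pm(z),$$ where $\delta(u)=\sum_{k\in\mathbb Z}u^k$ and $g(u)=\frac{q^2u-1}{u-q^2}$ is expanded about $u=0$. Grade $U$ by giving $x^\pm(n),\varphi(n),\psi(n)$ degree $n$ and $q^{\pm c/2}$ degree $0$. Define $a_n\in U$ for $n\neq0$ by $$(q-q^{-1})\sum_{n>0}a_nz^{-n}=\log\big(\psi(z)\psi(0)^{-1}\big),\qquad -(q-q^{-1})\sum_{n>0}a_{-n}z^{n}=\log\big(\varphi(z)\varphi(0)^{-1}\big).$$ (1) Let $$k^-(z)=\exp\Big[(q-q^{-1})\sum_{n>0}-\frac{q^{2n+nc/2}}{1+q^{2n}}\,a_nz^{-n}\Big].$$ Then $k^-(z)=1+\sum_{n>0}k^-(n)z^{-n}$, where each $k^-(n)$ has degree $n$ and the $k^-(n)$ commute with each other, and $$k^-(z)x^+(w)=\frac{z-wq^2}{z-w}\,x^+(w)k^-(z),$$ the fraction being expanded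 in powers of $w/z$. (2) Let $$k^+(z)=\exp\Big[-(q-q^{-1})\sum_{n<0}-\frac{q^{2|n|+|n|c/2}}{1+q^{2|n|}}\,a_nz^{-n}\Big].$$ Then $k^+(z)=1+\sum_{n<0}k^+(n)z^{-n}$, where each $k^+(n)$ has degree $n$ and the $k^+(n)$ commute with each other, and $$k^+(z)x^+(w)=\frac{z-w}{zq^2-w}\,x^+(w)k^+(z),$$ the fraction being expanded in powers of $z/w$. -/

import Mathlib

noncomputable section

namespace QAffine

/-- Generators of `U_q(sl₂^)` in the current realization. `phi m` is the mode `φ(-m)` and `psi m`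
is the mode `ψ(m)` (`m ≥ 0`); `gam`, `gamInv` stand for `q^{c/2}` and `q^{-c/2}`. -/
inductive Gen : Type
  | xp (l : ℤ)
  | xm (l : ℤ)
  | phi (m : ℕ)
  | psi (m : ℕ)
  | gam
  | gamInv

/-- The degree of a generator: `x^±(n)`, `φ(n)`, `ψ(n)` have degree `n`, and `q^{±c/2}` has
degree `0`. -/
def Gen.degree : Gen → ℤ
  | .xp l => l
  | .xm l => l
  | .phi m => -(m : ℤ)
  | .psi m => (m : ℤ)
  | .gam => 0
  | .gamInv => 0

/-- Extension by zero of a sequence indexed by `ℕ` to the integers. -/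
def extendZero {R : Type*} [Zero R] (f : ℕ → R) (n : ℤ) : R :=
  if 0 ≤ n then f n.toNat else 0

/-- Coefficient of a product `f(u) y(w) k(z)`, where `f(u) = ∑_{j ≥ 0} f_j u^j`,
`y(w) = ∑_{l ∈ ℤ} y(l) w^{-l}`, and
* for `s = 1`: `u = w/z`, `k(z) = ∑_{m ≥ 0} k_m z^{-m}`, coefficient of `z^{-m} w^{-l}`;
* for `s = -1`: `u = z/w`, `k(z) = ∑_{m ≥ 0} k_m z^m`, coefficient of `z^m w^{-l}`. -/
def exchangeCoeff {R : Type*} [Semiring R] (s : ℤ) (f : ℕ → R) (y : ℤ → R) (k : ℕ → R)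
    (m : ℕ) (l : ℤ) : R :=
  ∑ p ∈ Finset.HasAntidiagonal.antidiagonal m, f p.1 * y (l + s * (p.1 : ℤ)) * k p.2

section Algebra

variable {K : Type*} [Field K]

/-- `g(u) = (q² u - 1) / (u - q²)`, expanded about `u = 0`. -/
def gSeries (q : K) : PowerSeries K :=
  (PowerSeries.C (q ^ 2) * PowerSeries.X - 1) * (PowerSeries.X - PowerSeries.C (q ^ 2))⁻¹

variable (K) in
/-- `q^{jc/2}` in the free algebra on the generators. -/
def gamPow : ℤ → FreeAlgebra K Gen
  | Int.ofNat n => FreeAlgebra.ι K Gen.gam ^ n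
  | Int.negSucc n => FreeAlgebra.ι K Gen.gamInv ^ (n + 1)

/-- The coefficients of `f(u q^{ec/2})` for `f ∈ K[[u]]`. -/
def twist (f : PowerSeries K) (e : ℤ) (j : ℕ) : FreeAlgebra K Gen :=
  PowerSeries.coeff j f • gamPow K (e * (j : ℤ))

open FreeAlgebra Gen in
/-- The defining relations, coefficient by coefficient. -/
inductive Rel (q : K) : FreeAlgebra K Gen → FreeAlgebra K Gen → Prop
  /-- `q^{c/2}` is invertible and central. -/
  | gam_mul_gamInv : Rel q (ι K gam * ι K gamInv) 1
  | gamInv_mul_gam : Rel q (ι K gamInv * ι K gam) 1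
  | gam_central (y : Gen) : Rel q (ι K gam * ι K y) (ι K y * ι K gam)
  /-- `φ(0)` and `ψ(0)` are inverse to each other. -/
  | phi_zero_mul_psi_zero : Rel q (ι K (phi 0) * ι K (psi 0)) 1
  | psi_zero_mul_phi_zero : Rel q (ι K (psi 0) * ι K (phi 0)) 1
  /-- `φ(z) φ(w) = φ(w) φ(z)`. -/
  | phi_phi (m n : ℕ) : Rel q (ι K (phi m) * ι K (phi n)) (ι K (phi n) * ι K (phi m))
  /-- `ψ(z) ψ(w) = ψ(w) ψ(z)`. -/
  | psi_psi (m n : ℕ) : Rel q (ι K (psi m) * ι K (psi n)) (ι K (psi n) * ι K (psi m))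
  /-- `φ(z) ψ(w) = g((z/w) q^{-c}) g((z/w) q^c)⁻¹ ψ(w) φ(z)`. -/
  | phi_psi (m n : ℕ) : Rel q (ι K (phi m) * ι K (psi n))
      (exchangeCoeff (-1)
        (fun j => ∑ p ∈ Finset.HasAntidiagonal.antidiagonal j,
          twist (gSeries q) (-2) p.1 * twist (gSeries q)⁻¹ 2 p.2)
        (extendZero fun i => ι K (psi i)) (fun i => ι K (phi i)) m (n : ℤ))
  /-- `φ(z) x^+(w) = g((z/w) q^{-c/2}) x^+(w) φ(z)`. -/
  | phi_xp (m : ℕ) (l : ℤ) : Rel q (ι K (phi m) * ι K (xp l))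
      (exchangeCoeff (-1) (twist (gSeries q) (-1)) (fun i => ι K (xp i))
        (fun i => ι K (phi i)) m l)
  /-- `φ(z) x^-(w) = g((z/w) q^{c/2})⁻¹ x^-(w) φ(z)`. -/
  | phi_xm (m : ℕ) (l : ℤ) : Rel q (ι K (phi m) * ι K (xm l))
      (exchangeCoeff (-1) (twist (gSeries q)⁻¹ 1) (fun i => ι K (xm i))
        (fun i => ι K (phi i)) m l)
  /-- `ψ(z) x^+(w) = g((w/z) q^{-c/2})⁻¹ x^+(w) ψ(z)`. -/
  | psi_xp (m : ℕ) (l : ℤ) : Rel q (ι K (psi m) * ι K (xp l))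
      (exchangeCoeff 1 (twist (gSeries q)⁻¹ (-1)) (fun i => ι K (xp i))
        (fun i => ι K (psi i)) m l)
  /-- `ψ(z) x^-(w) = g((w/z) q^{c/2}) x^-(w) ψ(z)`. -/
  | psi_xm (m : ℕ) (l : ℤ) : Rel q (ι K (psi m) * ι K (xm l))
      (exchangeCoeff 1 (twist (gSeries q) 1) (fun i => ι K (xm i))
        (fun i => ι K (psi i)) m l)
  /-- `[x^+(z), x^-(w)] = (q - q⁻¹)⁻¹ (δ((z/w) q^{-c}) ψ(w q^{c/2}) - δ((z/w) q^c) φ(z q^{c/2}))`,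
  coefficient of `z^{-k} w^{-l}`. -/
  | xp_xm (k l : ℤ) : Rel q (ι K (xp k) * ι K (xm l) - ι K (xm l) * ι K (xp k))
      ((q - q⁻¹)⁻¹ •
        (gamPow K (k - l) * extendZero (fun i => ι K (psi i)) (k + l)
          - gamPow K (l - k) * extendZero (fun i => ι K (phi i)) (-(k + l))))
  /-- `(z - q² w) x^+(z) x^+(w) = (q² z - w) x^+(w) x^+(z)`, coefficient of `z^{-k} w^{-l}`. -/
  | xp_xp (k l : ℤ) : Rel q
      (ι K (xp (k + 1)) * ι K (xp l) - q ^ 2 • (ι K (xp k) * ι K (xp (l + 1))))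
      (q ^ 2 • (ι K (xp l) * ι K (xp (k + 1))) - ι K (xp (l + 1)) * ι K (xp k))
  /-- `(z - q⁻² w) x^-(z) x^-(w) = (q⁻² z - w) x^-(w) x^-(z)`, coefficient of `z^{-k} w^{-l}`. -/
  | xm_xm (k l : ℤ) : Rel q
      (ι K (xm (k + 1)) * ι K (xm l) - (q ^ 2)⁻¹ • (ι K (xm k) * ι K (xm (l + 1))))
      ((q ^ 2)⁻¹ • (ι K (xm l) * ι K (xm (k + 1))) - ι K (xm (l + 1)) * ι K (xm k))

/-- The quantum affine algebra `U_q(sl₂^)`. -/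
abbrev Uq (q : K) : Type _ := RingQuot (Rel q)

/-- The image of a generator in `U_q(sl₂^)`. -/
def gen (q : K) (y : Gen) : Uq q := RingQuot.mkAlgHom K (Rel q) (FreeAlgebra.ι K y)

/-- The homogeneous component of degree `d`, spanned by the monomials of total degree `d`. -/
def homogeneous (q : K) (d : ℤ) : Submodule K (Uq q) :=
  Submodule.span K {y | ∃ w : List Gen, (w.map Gen.degree).sum = d ∧ y = (w.map (gen q)).prod}

/-- `φ(z)`, as a power series in `z`. -/
def phiSeries (q : K) : PowerSeries (Uq q) := PowerSeries.mk fun m => gen q (Gen.phi m)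

/-- `ψ(z)`, as a power series in `z⁻¹`. -/
def psiSeries (q : K) : PowerSeries (Uq q) := PowerSeries.mk fun m => gen q (Gen.psi m)

/-- `∑_j c_j f^j` for a power series `f` without constant term: `f^j` has no terms of order
less than `j`, so the coefficient of order `n` only involves `j ≤ n`. -/
def evalAt {R : Type*} [Ring R] [Algebra K R] (c : ℕ → K) (f : PowerSeries R) : PowerSeries R :=
  PowerSeries.mk fun n => ∑ j ∈ Finset.range (n + 1), c j • PowerSeries.coeff n (f ^ j)

variable (K) in
/-- `exp f`, for `f` without constant term. -/
def expSeries {R : Type*} [Ring R] [Algebra K R] (f : PowerSeries R) : PowerSeries R :=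
  evalAt (fun j => ((j.factorial : K))⁻¹) f

variable (K) in
/-- `log (1 + (f - 1)) = ∑_{j > 0} (-1)^{j+1} (f - 1)^j / j`, for `f` with constant term `1`. -/
def logSeries {R : Type*} [Ring R] [Algebra K R] (f : PowerSeries R) : PowerSeries R :=
  evalAt (fun j => if j = 0 then 0 else (-1) ^ (j + 1) / (j : K)) (f - 1)

/-- The elements `a_n`, `n ≠ 0` (the value at `n = 0` is irrelevant), determined by
`(q - q⁻¹) ∑_{n > 0} a_n z^{-n} = log (ψ(z) ψ(0)⁻¹)` and
`-(q - q⁻¹) ∑_{n > 0} a_{-n} z^n = log (φ(z) φ(0)⁻¹)`; here `ψ(0)⁻¹ = φ(0)`. -/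
def a (q : K) (n : ℤ) : Uq q :=
  if 0 < n then
    (q - q⁻¹)⁻¹ • PowerSeries.coeff n.toNat
      (logSeries K (psiSeries q * PowerSeries.C (gen q (Gen.phi 0))))
  else
    -((q - q⁻¹)⁻¹ • PowerSeries.coeff (-n).toNat
      (logSeries K (phiSeries q * PowerSeries.C (gen q (Gen.psi 0)))))

/-- `k^-(z) = exp[(q - q⁻¹) ∑_{n>0} -(q^{2n + nc/2} / (1 + q^{2n})) a_n z^{-n}]`, as a power series
in `z⁻¹`. -/
def kMinus (q : K) : PowerSeries (Uq q) :=
  expSeries K (PowerSeries.mk fun n => if n = 0 then 0 else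
    ((q - q⁻¹) * -(q ^ (2 * n) / (1 + q ^ (2 * n)))) • (gen q Gen.gam ^ n * a q (n : ℤ)))

/-- `k^+(z) = exp[-(q - q⁻¹) ∑_{n>0} -(q^{2n + nc/2} / (1 + q^{2n})) a_{-n} z^n]`, as a power series
in `z`. -/
def kPlus (q : K) : PowerSeries (Uq q) :=
  expSeries K (PowerSeries.mk fun n => if n = 0 then 0 else
    (-(q - q⁻¹) * -(q ^ (2 * n) / (1 + q ^ (2 * n)))) • (gen q Gen.gam ^ n * a q (-(n : ℤ))))

/-- `(z - w q²) / (z - w)` expanded in `u = w/z`. -/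
def factorMinus (q : K) : PowerSeries K :=
  (1 - PowerSeries.C (q ^ 2) * PowerSeries.X) * (1 - PowerSeries.X)⁻¹

/-- `(z - w) / (z q² - w)` expanded in `u = z/w`. -/
def factorPlus (q : K) : PowerSeries K :=
  (PowerSeries.X - 1) * (PowerSeries.C (q ^ 2) * PowerSeries.X - 1)⁻¹

end Algebra

end QAffine

end

noncomputable section

namespace QAffine

open Finset PowerSeries

variable {K : Type*} [Field K]

/-! ### Exchange relations versus commutators with the logarithm -/

section Exchange

variable {R : Type*} [Ring R] [Algebra K R]

/-! If `P` and `G` have constant term 1, the relation `P(z) x(w) = G(u) x(w) P(z)` is equivalent to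
`[log P(z), x(w)] = log G(u) · x(w)`. The latter is linear in each mode of `log P`, so multiplying
the `n`th mode by a scalar `r n` multiplies the `n`th coefficient of `log G` by `r n`, and
exponentiating gives a new exchange relation.

Here `P` is `ψ(z)ψ(0)⁻¹` or `φ(z)φ(0)⁻¹`, with `q^{-c/2}` removed by rescaling the variable. For `G
= (1 - βu)/(1 - αu)` the `n`th coefficient of `log G` is `(α^n - β^n)/n`. For `ψ`, `α = q²` and `β =
q⁻²`; since `-q^{2n}/(1 + q^{2n}) · (q^{2n} - q^{-2n}) = 1 - q^{2n}`, the new factor is `(1 -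
q²u)/(1 - u)`. For `φ` both factors are inverted.

The equivalence uses logarithmic derivatives: `natCast_smul_exchangeDefect` links the failures of
the two relations, and induction on the mode gives `bracketDefect_eq_zero` and
`exchangeDefect_eq_zero`. The logarithm and exponential are computed in a commutative subalgebra
containing the modes of the current. -/

/-- The failure of `P(z) x(w) = G(u) x(w) P(z)`, in the coefficient indexed by `m` and `l`. -/
def exchangeDefect (s : ℤ) (G : ℕ → K) (x : ℤ → R) (P : ℕ → R) (m : ℕ) (l : ℤ) : R :=
  P m * x l - ∑ p ∈ antidiagonal m, G p.1 • (x (l + s * (p.1 : ℤ)) * P p.2)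

/-- The failure of `[L(z), x(w)] = e(u) x(w)`, in the coefficient indexed by `m` and `l`. -/
def bracketDefect (s : ℤ) (e : ℕ → K) (x : ℤ → R) (L : ℕ → R) (m : ℕ) (l : ℤ) : R :=
  L m * x l - x l * L m - e m • x (l + s * (m : ℤ))

/-- If `P` and `G` have logarithmic derivatives `L'` and `e'`, the two defects are related. -/
theorem natCast_smul_exchangeDefect {s : ℤ} {G e : ℕ → K} {x : ℤ → R} {P L : ℕ → R}
    (hP : ∀ n : ℕ, (n : K) • P n = ∑ p ∈ antidiagonal n, (p.1 : K) • (L p.1 * P p.2))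
    (hG : ∀ n : ℕ, (n : K) * G n = ∑ p ∈ antidiagonal n, (p.2 : K) * e p.2 * G p.1)
    (m : ℕ) (l : ℤ) :
    (m : K) • exchangeDefect s G x P m l =
      ∑ p ∈ antidiagonal m, (p.1 : K) • (L p.1 * exchangeDefect s G x P p.2 l) +
      ∑ p ∈ antidiagonal m, ∑ r ∈ antidiagonal p.2,
        ((r.1 : K) * G p.1) •
          (bracketDefect s e x L r.1 (l + s * (p.1 : ℤ)) * P r.2) := by
  have h1 : (m : K) • (P m * x l) =
      ∑ p ∈ antidiagonal m, (p.1 : K) • (L p.1 * (P p.2 * x l)) := by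
    rw [← smul_mul_assoc, hP, sum_mul]
    simp only [smul_mul_assoc, mul_assoc]
  -- `h2`, `h3`, `h4` treat the three terms of the bracket: the first cancels against the `L · (G x
  -- P)` part of the recursion; the other two form the Leibniz rule for `G x P` in `h5`.
  have h2 : ∑ p ∈ antidiagonal m, ∑ r ∈ antidiagonal p.2,
        ((r.1 : K) * G p.1) • (L r.1 * x (l + s * (p.1 : ℤ)) * P r.2) =
      ∑ p ∈ antidiagonal m, ∑ r ∈ antidiagonal p.2,
        ((p.1 : K) * G r.1) • (L p.1 * (x (l + s * (r.1 : ℤ)) * P r.2)) := by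
    simp only [Finset.sum_sigma']
    refine Finset.sum_bij' (fun a _ => ⟨(a.2.1, a.1.1 + a.2.2), (a.1.1, a.2.2)⟩)
      (fun a _ => ⟨(a.2.1, a.1.1 + a.2.2), (a.1.1, a.2.2)⟩) ?_ ?_ ?_ ?_ ?_
    all_goals
      rintro ⟨⟨i, c⟩, ⟨j, r⟩⟩ h
      simp only [mem_sigma, HasAntidiagonal.mem_antidiagonal, and_true] at h ⊢
    · omega
    · omega
    · obtain ⟨rfl, rfl⟩ := h; rfl
    · obtain ⟨rfl, rfl⟩ := h; rfl
    · rw [mul_assoc]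
  have h3 : ∑ p ∈ antidiagonal m, ∑ r ∈ antidiagonal p.2,
        ((r.1 : K) * G p.1) • (x (l + s * (p.1 : ℤ)) * L r.1 * P r.2) =
      ∑ p ∈ antidiagonal m, ((p.2 : K) * G p.1) • (x (l + s * (p.1 : ℤ)) * P p.2) := by
    refine sum_congr rfl fun p _ => ?_
    rw [mul_comm (p.2 : K), mul_smul, ← mul_smul_comm, hP, mul_sum, smul_sum]
    refine sum_congr rfl fun r _ => ?_
    rw [mul_smul_comm, smul_smul, mul_comm (r.1 : K), mul_assoc]
  have h4 : ∑ p ∈ antidiagonal m, ∑ r ∈ antidiagonal p.2,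
        ((r.1 : K) * G p.1) • (e r.1 • x (l + s * (p.1 : ℤ) + s * (r.1 : ℤ)) * P r.2) =
      ∑ p ∈ antidiagonal m, ((p.1 : K) * G p.1) • (x (l + s * (p.1 : ℤ)) * P p.2) := by
    simp only [hG, sum_smul]
    simp only [Finset.sum_sigma']
    refine Finset.sum_bij' (fun a _ => ⟨(a.1.1 + a.2.1, a.2.2), (a.1.1, a.2.1)⟩)
      (fun a _ => ⟨(a.2.1, a.2.2 + a.1.2), (a.2.2, a.1.2)⟩) ?_ ?_ ?_ ?_ ?_
    all_goals
      rintro ⟨⟨i, c⟩, ⟨j, r⟩⟩ h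
      simp only [mem_sigma, HasAntidiagonal.mem_antidiagonal, and_true] at h ⊢
    · omega
    · omega
    · obtain ⟨rfl, rfl⟩ := h; rfl
    · obtain ⟨rfl, rfl⟩ := h; rfl
    · rw [smul_mul_assoc, smul_smul]
      push_cast
      rw [mul_add, add_assoc]
      congr 1
      ring
  have h5 : (m : K) • ∑ p ∈ antidiagonal m, G p.1 • (x (l + s * (p.1 : ℤ)) * P p.2) =
      ∑ p ∈ antidiagonal m, ((p.2 : K) * G p.1) • (x (l + s * (p.1 : ℤ)) * P p.2) +
      ∑ p ∈ antidiagonal m, ((p.1 : K) * G p.1) • (x (l + s * (p.1 : ℤ)) * P p.2) := by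
    rw [smul_sum, ← sum_add_distrib]
    refine sum_congr rfl fun p hp => ?_
    rw [smul_smul, ← add_smul, ← HasAntidiagonal.mem_antidiagonal.1 hp]
    push_cast
    congr 1
    ring
  have h6 : ∑ p ∈ antidiagonal m, (p.1 : K) • (L p.1 * exchangeDefect s G x P p.2 l) =
      ∑ p ∈ antidiagonal m, (p.1 : K) • (L p.1 * (P p.2 * x l)) -
      ∑ p ∈ antidiagonal m, ∑ r ∈ antidiagonal p.2,
        ((p.1 : K) * G r.1) • (L p.1 * (x (l + s * (r.1 : ℤ)) * P r.2)) := by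
    rw [← sum_sub_distrib]
    refine sum_congr rfl fun p _ => ?_
    rw [exchangeDefect, mul_sub, smul_sub, mul_sum, smul_sum]
    simp only [mul_smul_comm, smul_smul]
  have h7 : ∑ p ∈ antidiagonal m, ∑ r ∈ antidiagonal p.2,
        ((r.1 : K) * G p.1) •
          (bracketDefect s e x L r.1 (l + s * (p.1 : ℤ)) * P r.2) =
      ∑ p ∈ antidiagonal m, ∑ r ∈ antidiagonal p.2,
        ((r.1 : K) * G p.1) • (L r.1 * x (l + s * (p.1 : ℤ)) * P r.2) -
      ∑ p ∈ antidiagonal m, ∑ r ∈ antidiagonal p.2,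
        ((r.1 : K) * G p.1) • (x (l + s * (p.1 : ℤ)) * L r.1 * P r.2) -
      ∑ p ∈ antidiagonal m, ∑ r ∈ antidiagonal p.2,
        ((r.1 : K) * G p.1) • (e r.1 • x (l + s * (p.1 : ℤ) + s * (r.1 : ℤ)) * P r.2) := by
    simp only [← sum_sub_distrib, ← smul_sub, ← sub_mul, bracketDefect]
  rw [h6, h7, h2, h3, h4, exchangeDefect, smul_sub, h1, h5]
  abel

variable [CharZero K]

/-- The exponential direction: with vanishing brackets, `m` times the defect is a combination of
defects of lower order, because the weight `p.1` kills the term of order `m`. -/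
theorem exchangeDefect_eq_zero {s : ℤ} {G e : ℕ → K} {x : ℤ → R} {P L : ℕ → R}
    (hP : ∀ n : ℕ, (n : K) • P n = ∑ p ∈ antidiagonal n, (p.1 : K) • (L p.1 * P p.2))
    (hG : ∀ n : ℕ, (n : K) * G n = ∑ p ∈ antidiagonal n, (p.2 : K) * e p.2 * G p.1)
    (hP0 : P 0 = 1) (hG0 : G 0 = 1) (h : ∀ m l, 0 < m → bracketDefect s e x L m l = 0)
    (m : ℕ) (l : ℤ) : exchangeDefect s G x P m l = 0 := by
  induction m using Nat.strong_induction_on with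
  | _ m ih =>
    rcases Nat.eq_zero_or_pos m with rfl | hm
    · simp [exchangeDefect, hP0, hG0]
    · have key := natCast_smul_exchangeDefect (s := s) (x := x) hP hG m l
      rw [sum_eq_zero, sum_eq_zero, add_zero, smul_eq_zero] at key
      · exact key.resolve_left (by exact_mod_cast hm.ne')
      · intro p _
        refine sum_eq_zero fun r _ => ?_
        rcases Nat.eq_zero_or_pos r.1 with h0 | h0
        · simp [h0]
        · rw [h _ _ h0, zero_mul, smul_zero]
      · intro p hp
        have := HasAntidiagonal.mem_antidiagonal.1 hp
        rcases Nat.eq_zero_or_pos p.1 with h0 | h0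
        · simp [h0]
        · rw [ih _ (by omega), mul_zero, smul_zero]

/-- The logarithmic direction. The induction runs over all `l` at once, since the recursion
evaluates lower brackets at shifted modes of `x`. -/
theorem bracketDefect_eq_zero {s : ℤ} {G e : ℕ → K} {x : ℤ → R} {P L : ℕ → R}
    (hP : ∀ n : ℕ, (n : K) • P n = ∑ p ∈ antidiagonal n, (p.1 : K) • (L p.1 * P p.2))
    (hG : ∀ n : ℕ, (n : K) * G n = ∑ p ∈ antidiagonal n, (p.2 : K) * e p.2 * G p.1)
    (hP0 : P 0 = 1) (hG0 : G 0 = 1) (h : ∀ m l, exchangeDefect s G x P m l = 0)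
    (m : ℕ) (l : ℤ) (hm : 0 < m) : bracketDefect s e x L m l = 0 := by
  induction m using Nat.strong_induction_on generalizing l with
  | _ m ih =>
    have key := natCast_smul_exchangeDefect (s := s) (x := x) hP hG m l
    simp only [h, mul_zero, smul_zero, sum_const_zero, zero_add] at key
    -- Only the term with `G 0` and `P 0` contains the bracket of order `m`; every other term has
    -- lower order or weight zero.
    rw [sum_eq_single (0, m), sum_eq_single (m, 0)] at key
    · simp only [hG0, hP0, mul_one, Nat.cast_zero, mul_zero, add_zero] at key
      exact (smul_eq_zero.1 key.symm).resolve_left (by exact_mod_cast hm.ne')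
    · rintro ⟨j, r⟩ hr hne
      have hr' : j + r = m := HasAntidiagonal.mem_antidiagonal.1 hr
      rcases Nat.eq_zero_or_pos j with rfl | h0
      · simp
      · have : r ≠ 0 := by
          rintro rfl
          exact hne (by simp at hr' ⊢; exact hr')
        rw [ih j (by omega) _ h0, zero_mul, smul_zero]
    · intro hn; exact absurd (HasAntidiagonal.mem_antidiagonal.2 (add_zero m)) hn
    · rintro ⟨i, c⟩ hp hne
      have hp' : i + c = m := HasAntidiagonal.mem_antidiagonal.1 hp
      refine sum_eq_zero fun r hr => ?_
      have hr' : r.1 + r.2 = c := HasAntidiagonal.mem_antidiagonal.1 hr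
      rcases Nat.eq_zero_or_pos r.1 with h0 | h0
      · simp [h0]
      · have : i ≠ 0 := by
          rintro rfl
          exact hne (by simp at hp' ⊢; exact hp')
        rw [ih _ (by omega) _ h0, zero_mul, smul_zero]
    · intro hn; exact absurd (HasAntidiagonal.mem_antidiagonal.2 (zero_add m)) hn

end Exchange

/-! ### Formal exponential and logarithm -/

section EvalAt

theorem evalAt_map {A R : Type*} [Ring A] [Algebra K A] [Ring R] [Algebra K R] (i : A →ₐ[K] R)
    (c : ℕ → K) (f : PowerSeries A) :
    evalAt c (PowerSeries.map (i : A →+* R) f) = PowerSeries.map (i : A →+* R) (evalAt c f) := by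
  ext n
  simp [evalAt, ← map_pow]

variable {A : Type*} [CommRing A] [Algebra K A]

/-- `X ^ j` divides `f ^ j`, so truncating at `j ≤ n` loses nothing. This makes the chain rule for
substitution available. -/
theorem evalAt_eq_subst (c : ℕ → K) {f : PowerSeries A} (hf : constantCoeff f = 0) :
    evalAt c f = (PowerSeries.mk fun n => algebraMap K A (c n)).subst f := by
  ext n
  rw [coeff_subst' (HasSubst.of_constantCoeff_zero' hf), evalAt, coeff_mk,
    finsum_eq_sum_of_support_subset]
  · refine sum_congr rfl fun j _ => ?_
    rw [coeff_mk, Algebra.smul_def, smul_eq_mul]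
  · intro j hj
    simp only [coe_range, Set.mem_Iio]
    by_contra hlt
    refine hj ?_
    dsimp only
    have : X ^ j ∣ f ^ j := pow_dvd_pow_of_dvd (X_dvd_iff.2 hf) j
    rw [X_pow_dvd_iff.1 this n (by omega), smul_zero]

theorem evalAt_rescale (c : ℕ → K) (γ : A) (f : PowerSeries A) :
    evalAt c (rescale γ f) = rescale γ (evalAt c f) := by
  ext n
  simp only [evalAt, ← map_pow, coeff_rescale, coeff_mk, mul_sum, mul_smul_comm]

theorem constantCoeff_evalAt (c : ℕ → K) (f : PowerSeries A) :
    constantCoeff (evalAt c f) = algebraMap K A (c 0) := by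
  rw [← coeff_zero_eq_constantCoeff_apply, evalAt, coeff_mk]
  simp [Algebra.smul_def]

variable [CharZero K]

theorem derivative_expSeries {f : PowerSeries A} (hf : constantCoeff f = 0) :
    derivative A (expSeries K f) = expSeries K f * derivative A f := by
  rw [expSeries, evalAt_eq_subst _ hf, derivative_subst (HasSubst.of_constantCoeff_zero' hf)]
  congr 2
  ext n
  rw [coeff_derivative, coeff_mk, coeff_mk, ← Nat.cast_succ, ← map_natCast (algebraMap K A),
    ← map_mul, Nat.factorial_succ]
  congr 1
  have := Nat.cast_ne_zero (R := K).2 (Nat.succ_ne_zero n)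
  have := Nat.cast_ne_zero (R := K).2 (Nat.factorial_ne_zero n)
  push_cast at *
  field_simp

theorem derivative_logSeries {f : PowerSeries A} (hf : constantCoeff f = 1) :
    f * derivative A (logSeries K f) = derivative A f := by
  have hf' : constantCoeff (f - 1) = 0 := by simp [hf]
  have hs := HasSubst.of_constantCoeff_zero' hf'
  rw [logSeries, evalAt_eq_subst _ hf', derivative_subst hs, map_sub, derivative_one, sub_zero,
    ← mul_assoc]
  have h1 : f = (1 + X : PowerSeries A).subst (f - 1) := by
    rw [subst_add hs, subst_X hs, ← coe_substAlgHom hs, map_one]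
    ring
  nth_rw 1 [h1]
  rw [← subst_mul hs]
  -- The derivative of `log (1 + X)` is the geometric series of `-X`.
  have h2 : (1 + X : PowerSeries A) * derivative A (PowerSeries.mk fun n =>
      algebraMap K A (if n = 0 then 0 else (-1) ^ (n + 1) / (n : K))) = 1 := by
    have h3 : derivative A (PowerSeries.mk fun n =>
        algebraMap K A (if n = 0 then 0 else (-1) ^ (n + 1) / (n : K))) =
        PowerSeries.mk fun n => (-1 : A) ^ n := by
      ext n
      rw [coeff_derivative, coeff_mk, coeff_mk, ← Nat.cast_succ, ← map_natCast (algebraMap K A),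
        ← map_mul, if_neg (Nat.succ_ne_zero n),
        div_mul_cancel₀ _ (Nat.cast_ne_zero.2 (Nat.succ_ne_zero n))]
      simp [pow_succ]
    rw [h3]
    ext n
    cases n with
    | zero => simp [add_mul]
    | succ n => simp [add_mul, coeff_succ_X_mul, pow_succ, coeff_one]
  rw [h2, ← coe_substAlgHom hs, map_one, one_mul]

end EvalAt

/-! ### Logarithmic derivatives in coefficients -/

section LogDeriv

variable {A : Type*} [CommRing A]

/-- Multiplying by `X` turns the derivative into the Euler operator, which scales the `n`th
coefficient by `n`. -/
theorem natCast_mul_coeff_of_derivative_eq {P L : PowerSeries A}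
    (h : derivative A P = P * derivative A L) (n : ℕ) :
    (n : A) * coeff n P = ∑ p ∈ antidiagonal n, (p.1 : A) * coeff p.1 L * coeff p.2 P := by
  have hX (f : PowerSeries A) (n : ℕ) : coeff n (X * derivative A f) = (n : A) * coeff n f := by
    cases n with
    | zero => simp
    | succ n => rw [coeff_succ_X_mul, coeff_derivative, mul_comm]; push_cast; rfl
  rw [← hX, h, mul_left_comm, mul_comm, coeff_mul]
  simp only [hX]

/-- The logarithmic derivative of `(1 - β X) / (1 - α X)`. -/
theorem derivative_of_mul_one_sub [CharZero K] {F : PowerSeries K} {α β : K}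
    (h : F * (1 - C α * X) = 1 - C β * X) :
    derivative K F = F * derivative K (PowerSeries.mk fun n => (α ^ n - β ^ n) / (n : K)) := by
  have hD : derivative K (PowerSeries.mk fun n => (α ^ n - β ^ n) / (n : K)) =
      PowerSeries.mk fun n => α * α ^ n - β * β ^ n := by
    ext n
    rw [coeff_derivative, coeff_mk, coeff_mk, ← Nat.cast_succ,
        div_mul_cancel₀ _ (Nat.cast_ne_zero.2 (Nat.succ_ne_zero n)), pow_succ', pow_succ']
  have hgeo (γ : K) : (PowerSeries.mk fun n => γ * γ ^ n) * (1 - C γ * X) = C γ := by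
    ext n
    cases n with
    | zero => simp [mul_sub]
    | succ n =>
      rw [mul_sub, mul_one, ← mul_assoc, map_sub, coeff_succ_mul_X, mul_comm _ (C γ), coeff_C_mul]
      simp [pow_succ']
  have hs : (PowerSeries.mk fun n => α * α ^ n - β * β ^ n) =
      (PowerSeries.mk fun n => α * α ^ n) - PowerSeries.mk fun n => β * β ^ n := by
    ext n; simp
  have hne : (1 - C α * X : PowerSeries K) ≠ 0 := fun h0 => by
    simpa using congrArg constantCoeff h0
  have hd := congrArg (derivative K) h
  simp only [Derivation.leibniz, map_sub, derivative_one, derivative_C, derivative_X, smul_eq_mul,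
    mul_zero, add_zero, mul_one, zero_sub] at hd
  rw [hD, hs]
  -- One factor `1 - αX` clears the denominator of `F`, the other that of the geometric series in
  -- `α`.
  refine mul_right_cancel₀ (mul_ne_zero hne hne) ?_
  linear_combination (1 - C α * X) * hd - (1 - C β * X) * hgeo α + (1 - C α * X) * hgeo β
    - (1 - C α * X) * ((PowerSeries.mk fun n => α * α ^ n) - PowerSeries.mk fun n => β * β ^ n) * h
    + C α * h

end LogDeriv

/-! ### Rescaling the modes of a logarithm -/

section ExpLog

variable {A : Type*} [CommRing A] [Algebra K A] {R : Type*} [Ring R] [Algebra K R]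

theorem natCast_smul_map_coeff (i : A →ₐ[K] R) {P L : PowerSeries A}
    (h : derivative A P = P * derivative A L) (n : ℕ) :
    (n : K) • i (coeff n P) =
      ∑ p ∈ antidiagonal n, (p.1 : K) • (i (coeff p.1 L) * i (coeff p.2 P)) := by
  have := congrArg i (natCast_mul_coeff_of_derivative_eq h n)
  simpa [Algebra.smul_def, mul_assoc] using this

theorem coeff_zero_of_mul_one_sub {F : PowerSeries K} {α β : K}
    (h : F * (1 - C α * X) = 1 - C β * X) : coeff 0 F = 1 := by
  simpa using congrArg constantCoeff h

variable [CharZero K]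

theorem natCast_mul_coeff_of_mul_one_sub {F : PowerSeries K} {α β : K}
    (h : F * (1 - C α * X) = 1 - C β * X) (n : ℕ) :
    (n : K) * coeff n F =
      ∑ p ∈ antidiagonal n, (p.2 : K) * ((α ^ p.2 - β ^ p.2) / (p.2 : K)) * coeff p.1 F := by
  rw [natCast_mul_coeff_of_derivative_eq (derivative_of_mul_one_sub h),
    ← Nat.sum_antidiagonal_swap]
  simp

/-- Rescaling the modes of `log P` by `r` turns an exchange relation for `P` with factor
`(1 - β u) / (1 - α u)` into one with factor `(1 - β' u) / (1 - α' u)`. -/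
theorem exchangeDefect_exp_smul_log (i : A →ₐ[K] R) {s : ℤ} {x : ℤ → R} {P : PowerSeries A}
    (hP : constantCoeff P = 1) (γ : A) {G F : PowerSeries K} {α β α' β' : K}
    (hG : G * (1 - C α * X) = 1 - C β * X) (hF : F * (1 - C α' * X) = 1 - C β' * X)
    (h : ∀ m l, exchangeDefect s (fun n => coeff n G) x
      (fun n => i (γ ^ n * coeff n P)) m l = 0)
    {r : ℕ → K} (hr : ∀ n, 0 < n → r n * (α ^ n - β ^ n) = α' ^ n - β' ^ n) (m : ℕ) (l : ℤ) :
    exchangeDefect s (fun n => coeff n F) x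
      (fun n => i (coeff n (expSeries K (PowerSeries.mk fun n => if n = 0 then 0 else
        r n • (γ ^ n * coeff n (logSeries K P)))))) m l = 0 := by
  have hlog : logSeries K (rescale γ P) = rescale γ (logSeries K P) := by
    rw [logSeries, logSeries, ← evalAt_rescale, map_sub, map_one]
  have hP' : constantCoeff (rescale γ P) = 1 := by
    rw [← coeff_zero_eq_constantCoeff_apply, coeff_rescale]
    simpa using hP
  have hb := bracketDefect_eq_zero (s := s) (x := x)
    (G := fun n => coeff n G) (e := fun n => (α ^ n - β ^ n) / (n : K))
    (P := fun n => i (coeff n (rescale γ P)))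
    (L := fun n => i (coeff n (logSeries K (rescale γ P))))
    (natCast_smul_map_coeff i (derivative_logSeries (K := K) hP').symm)
    (natCast_mul_coeff_of_mul_one_sub hG) (by simp only [coeff_zero_eq_constantCoeff_apply, hP', map_one])
    (coeff_zero_of_mul_one_sub hG)
    (by simpa only [coeff_rescale] using h)
  set E : PowerSeries A := PowerSeries.mk fun n => if n = 0 then 0 else
    r n • (γ ^ n * coeff n (logSeries K P)) with hE
  refine exchangeDefect_eq_zero (e := fun n => (α' ^ n - β' ^ n) / (n : K))
    (L := fun n => i (coeff n E))
    (natCast_smul_map_coeff i (derivative_expSeries (by simp [hE])))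
    (natCast_mul_coeff_of_mul_one_sub hF) ?_ (coeff_zero_of_mul_one_sub hF) ?_ m l
  · rw [coeff_zero_eq_constantCoeff_apply, expSeries, constantCoeff_evalAt]
    simp
  · intro m l hm
    -- The bracket relation is linear in the mode of the logarithm, so it may be scaled by `r m`.
    have := congrArg (r m • ·) (hb m l hm)
    simp only [bracketDefect, hlog, hE, coeff_rescale, smul_zero, smul_sub, smul_smul] at this ⊢
    rw [← this, coeff_mk, if_neg hm.ne', map_smul, smul_mul_assoc, mul_smul_comm, ← mul_div_assoc,
      hr m hm]

end ExpLog

/-! ### Exchange relations for noncommutative currents -/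

section Currents

universe u

variable {R : Type u} [Ring R] [Algebra K R]

/-- Allows power series identities over commutative rings to be used for commuting elements of `R`.
-/
theorem exists_commRing_algHom {T : Set R} (hcomm : ∀ a ∈ T, ∀ b ∈ T, a * b = b * a) :
    ∃ (A : Type u) (_ : CommRing A) (_ : Algebra K A) (i : A →ₐ[K] R),
      Function.Injective i ∧ ∀ t ∈ T, ∃ a, i a = t := by
  have := Algebra.isMulCommutative_adjoin K hcomm
  let _ : CommRing (Algebra.adjoin K T) :=
    { (inferInstance : Ring (Algebra.adjoin K T)) with mul_comm := mul_comm' }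
  exact ⟨Algebra.adjoin K T, inferInstance, inferInstance, (Algebra.adjoin K T).val,
    Subtype.val_injective, fun t ht => ⟨⟨t, Algebra.subset_adjoin ht⟩, rfl⟩⟩

variable [CharZero K]

/-- The series `exp (∑ r_n γ^n L_n)`, where `L = log (ψ ψ₀⁻¹)`, has commuting coefficients and
satisfies the exchange relation obtained by rescaling that of `ψ`. -/
theorem exp_smul_log_current {s : ℤ} {x : ℤ → R} {ψ : ℕ → R} {ω γ γ' : R}
    (hψ : ∀ m n, Commute (ψ m) (ψ n)) (hω : ω * ψ 0 = 1) (hω' : ψ 0 * ω = 1)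
    (hγ : γ * γ' = 1) (hγψ : ∀ n, Commute γ (ψ n)) (hγω : Commute γ ω)
    (hγx : ∀ l, Commute γ (x l)) {g F : PowerSeries K} {c α β α' β' : K} (hc : c ≠ 0)
    (hg : g * (1 - C α * X) = C c * (1 - C β * X)) (hF : F * (1 - C α' * X) = 1 - C β' * X)
    (h : ∀ m l, ψ m * x l =
      ∑ p ∈ antidiagonal m, coeff p.1 g • (γ' ^ p.1 * x (l + s * (p.1 : ℤ)) * ψ p.2))
    {r : ℕ → K} (hr : ∀ n, 0 < n → r n * (α ^ n - β ^ n) = α' ^ n - β' ^ n)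
    {k : PowerSeries R}
    (hk : k = expSeries K (PowerSeries.mk fun n => if n = 0 then 0 else
      r n • (γ ^ n * coeff n (logSeries K (PowerSeries.mk ψ * C ω))))) :
    coeff 0 k = 1 ∧ (∀ m n, Commute (coeff m k) (coeff n k)) ∧
      ∀ m l, coeff m k * x l = exchangeCoeff s (fun j => algebraMap K R (coeff j F)) x
        (fun j => coeff j k) m l := by
  have hωψ (n : ℕ) : Commute ω (ψ n) := by
    show ω * ψ n = ψ n * ω
    calc ω * ψ n = ω * (ψ n * ψ 0) * ω := by rw [mul_assoc, mul_assoc, hω', mul_one]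
      _ = ψ n * ω := by rw [(hψ n 0).eq, ← mul_assoc, hω, one_mul]
  have hcomm : ∀ a ∈ insert γ (insert ω (Set.range ψ)),
      ∀ b ∈ insert γ (insert ω (Set.range ψ)), a * b = b * a := by
    rintro a (rfl | rfl | ⟨m, rfl⟩) b (rfl | rfl | ⟨n, rfl⟩)
    · rfl
    · exact hγω
    · exact hγψ n
    · exact hγω.symm
    · rfl
    · exact hωψ n
    · exact (hγψ m).symm
    · exact (hωψ m).symm
    · exact hψ m n
  obtain ⟨A, _, _, i, hinj, hi⟩ := exists_commRing_algHom (K := K) hcomm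
  obtain ⟨γ₀, hγ₀⟩ := hi γ (by simp)
  obtain ⟨ω₀, hω₀⟩ := hi ω (by simp)
  choose ψ₀ hψ₀ using fun n => hi (ψ n) (by simp)
  let P : PowerSeries A := PowerSeries.mk ψ₀ * C ω₀
  have hmap : PowerSeries.map (i : A →+* R) P = PowerSeries.mk ψ * C ω := by
    ext n
    simp [P, hψ₀, hω₀]
  have hkmap : k = PowerSeries.map (i : A →+* R)
      (expSeries K (PowerSeries.mk fun n => if n = 0 then 0 else
        r n • (γ₀ ^ n * coeff n (logSeries K P)))) := by
    rw [hk, ← hmap, expSeries, expSeries, ← evalAt_map]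
    congr 1
    ext n
    have hl : logSeries K (PowerSeries.map (i : A →+* R) P) =
        PowerSeries.map (i : A →+* R) (logSeries K P) := by
      rw [logSeries, logSeries, ← evalAt_map, map_sub, map_one]
    rw [hl]
    by_cases hn : n = 0
    · simp [hn]
    · simp [hn, hγ₀]
  have hkc (n : ℕ) : coeff n k = i (coeff n (expSeries K (PowerSeries.mk fun n =>
      if n = 0 then 0 else r n • (γ₀ ^ n * coeff n (logSeries K P))))) := by
    rw [hkmap, coeff_map]
    rfl
  have hP : constantCoeff P = 1 := by
    refine hinj ?_
    simp [P, hψ₀, hω₀, hω']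
  have hg0 : coeff 0 g = c := by simpa using congrArg constantCoeff hg
  -- Moving `ω = (ψ 0)⁻¹` past `x` costs `c⁻¹`, which normalizes the constant term of `g` to 1.
  have hωx (l : ℤ) : ω * x l = c⁻¹ • (x l * ω) := by
    have h0 : ψ 0 * x l = c • (x l * ψ 0) := by simpa [hg0] using h 0 l
    calc ω * x l = c⁻¹ • (ω * (c • (x l * ψ 0)) * ω) := by
          rw [mul_smul_comm, smul_mul_assoc, smul_smul, inv_mul_cancel₀ hc, one_smul, mul_assoc,
            mul_assoc, hω', mul_one]
      _ = c⁻¹ • (x l * ω) := by rw [← h0, ← mul_assoc, hω, one_mul]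
  -- Weighting the `n`th mode by `γ ^ n` absorbs the powers of `γ'` in the relation.
  have hγpow (a b : ℕ) : γ ^ (a + b) * γ' ^ a = γ ^ b := by
    induction a with
    | zero => simp
    | succ a ih => rw [pow_succ' γ', ← mul_assoc, add_right_comm, pow_succ, mul_assoc (γ ^ (a + b)),
        hγ, mul_one, ih]
  refine ⟨?_, fun m n => ?_, fun m l => ?_⟩
  · rw [hkc, coeff_zero_eq_constantCoeff_apply, expSeries, constantCoeff_evalAt]
    simp
  · rw [hkc, hkc]
    exact (Commute.all _ _).map i
  · have := exchangeDefect_exp_smul_log i (s := s) (x := x) hP γ₀ (G := C c⁻¹ * g) (F := F)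
      (by rw [mul_assoc, hg, ← mul_assoc, ← map_mul, inv_mul_cancel₀ hc, map_one, one_mul])
      hF (fun m l => ?_) hr m l
    · simp only [← hkc] at this
      rw [exchangeDefect, sub_eq_zero] at this
      rw [this, exchangeCoeff]
      simp only [Algebra.smul_def, mul_assoc]
    · have hiP (n : ℕ) : i (γ₀ ^ n * coeff n P) = γ ^ n * (ψ n * ω) := by
        simp [P, hγ₀, hψ₀, hω₀]
      simp only [exchangeDefect, hiP, coeff_C_mul]
      rw [sub_eq_zero, mul_assoc, mul_assoc, hωx, mul_smul_comm, ← mul_assoc (ψ m), h, sum_mul,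
        smul_sum, mul_sum]
      refine sum_congr rfl fun p hp => ?_
      rw [← HasAntidiagonal.mem_antidiagonal.1 hp, smul_mul_assoc, smul_smul, mul_smul_comm]
      congr 1
      rw [mul_assoc (γ' ^ p.1), mul_assoc (γ' ^ p.1), ← mul_assoc (γ ^ _), hγpow,
        mul_assoc (x _), ← mul_assoc, ((hγx _).pow_left _).eq, mul_assoc]

end Currents

/-! ### Degrees of the coefficients -/

section Homogeneous

variable {q : K}

theorem one_mem_homogeneous : (1 : Uq q) ∈ homogeneous q 0 :=
  Submodule.subset_span ⟨[], by simp, by simp⟩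

theorem gen_mem_homogeneous (y : Gen) : gen q y ∈ homogeneous q y.degree :=
  Submodule.subset_span ⟨[y], by simp, by simp⟩

theorem mul_mem_homogeneous {d e : ℤ} {a b : Uq q} (ha : a ∈ homogeneous q d)
    (hb : b ∈ homogeneous q e) : a * b ∈ homogeneous q (d + e) := by
  have := Submodule.mul_mem_mul ha hb
  rw [homogeneous, homogeneous, Submodule.span_mul_span] at this
  refine Submodule.span_mono ?_ this
  rintro _ ⟨_, ⟨v, rfl, rfl⟩, _, ⟨w, rfl, rfl⟩, rfl⟩
  exact ⟨v ++ w, by simp, by simp⟩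

theorem gam_pow_mem_homogeneous (n : ℕ) : gen q Gen.gam ^ n ∈ homogeneous q 0 := by
  induction n with
  | zero => simpa using one_mem_homogeneous
  | succ n ih => simpa [pow_succ, Gen.degree] using mul_mem_homogeneous ih (gen_mem_homogeneous Gen.gam)

/-- The coefficient of order `n` has degree `s n`. -/
def IsGradedSeries (q : K) (s : ℤ) (f : PowerSeries (Uq q)) : Prop :=
  ∀ n : ℕ, coeff n f ∈ homogeneous q (s * n)

theorem IsGradedSeries.one (s : ℤ) : IsGradedSeries q s 1 := fun n => by
  rw [coeff_one]
  split_ifs with h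
  · simpa [h] using one_mem_homogeneous
  · exact zero_mem _

theorem IsGradedSeries.mul {s : ℤ} {f g : PowerSeries (Uq q)} (hf : IsGradedSeries q s f)
    (hg : IsGradedSeries q s g) : IsGradedSeries q s (f * g) := fun n => by
  rw [coeff_mul]
  refine sum_mem fun p hp => ?_
  rw [← HasAntidiagonal.mem_antidiagonal.1 hp, Nat.cast_add, mul_add]
  exact mul_mem_homogeneous (hf _) (hg _)

theorem IsGradedSeries.pow {s : ℤ} {f : PowerSeries (Uq q)} (hf : IsGradedSeries q s f) (n : ℕ) :
    IsGradedSeries q s (f ^ n) := by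
  induction n with
  | zero => rw [pow_zero]; exact .one s
  | succ n ih => rw [pow_succ]; exact ih.mul hf

theorem IsGradedSeries.evalAt {s : ℤ} {f : PowerSeries (Uq q)} (hf : IsGradedSeries q s f)
    (c : ℕ → K) : IsGradedSeries q s (evalAt c f) := fun n => by
  rw [QAffine.evalAt, coeff_mk]
  exact sum_mem fun j _ => Submodule.smul_mem _ _ (hf.pow j n)

theorem isGradedSeries_exp_smul_log {s : ℤ} {ψ : ℕ → Uq q} {ω : Uq q}
    (hψ : ∀ n : ℕ, ψ n ∈ homogeneous q (s * n)) (hω : ω ∈ homogeneous q 0) (r : ℕ → K) :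
    IsGradedSeries q s (expSeries K (PowerSeries.mk fun n => if n = 0 then 0 else
      r n • (gen q Gen.gam ^ n * coeff n (logSeries K (PowerSeries.mk ψ * C ω))))) := by
  refine IsGradedSeries.evalAt (fun n => ?_) _
  rw [coeff_mk]
  split_ifs with hn
  · exact zero_mem _
  · refine Submodule.smul_mem _ _ ?_
    rw [← zero_add (s * (n : ℤ))]
    refine mul_mem_homogeneous (gam_pow_mem_homogeneous n)
      (IsGradedSeries.evalAt (fun m => ?_) _ n)
    rw [map_sub]
    refine sub_mem ?_ (IsGradedSeries.one s m)
    rw [coeff_mul_C, coeff_mk, ← add_zero (s * (m : ℤ))]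
    exact mul_mem_homogeneous (hψ m) hω

end Homogeneous

/-! ### Defining relations in the quotient algebra -/

section Relations

variable (q : K)

theorem mkAlgHom_ι (y : Gen) : RingQuot.mkAlgHom K (Rel q) (FreeAlgebra.ι K y) = gen q y := rfl

theorem mkAlgHom_gamPow_neg (n : ℕ) :
    RingQuot.mkAlgHom K (Rel q) (gamPow K (-1 * (n : ℤ))) = gen q Gen.gamInv ^ n := by
  cases n with
  | zero => simp [gamPow]
  | succ n =>
    rw [show (-1 * ((n + 1 : ℕ) : ℤ)) = Int.negSucc n by rw [Int.negSucc_eq]; push_cast; ring,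
      gamPow, map_pow, mkAlgHom_ι]

theorem gam_mul_gamInv : gen q Gen.gam * gen q Gen.gamInv = 1 := by
  simpa [mkAlgHom_ι] using RingQuot.mkAlgHom_rel K (Rel.gam_mul_gamInv (q := q))

theorem commute_gam (y : Gen) : Commute (gen q Gen.gam) (gen q y) := by
  have := RingQuot.mkAlgHom_rel K (Rel.gam_central (q := q) y)
  simpa only [map_mul, mkAlgHom_ι, commute_iff_eq] using this

theorem phi_zero_mul_psi_zero : gen q (Gen.phi 0) * gen q (Gen.psi 0) = 1 := by
  simpa [mkAlgHom_ι] using RingQuot.mkAlgHom_rel K (Rel.phi_zero_mul_psi_zero (q := q))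

theorem psi_zero_mul_phi_zero : gen q (Gen.psi 0) * gen q (Gen.phi 0) = 1 := by
  simpa [mkAlgHom_ι] using RingQuot.mkAlgHom_rel K (Rel.psi_zero_mul_phi_zero (q := q))

theorem commute_phi (m n : ℕ) : Commute (gen q (Gen.phi m)) (gen q (Gen.phi n)) := by
  have := RingQuot.mkAlgHom_rel K (Rel.phi_phi (q := q) m n)
  simpa only [map_mul, mkAlgHom_ι, commute_iff_eq] using this

theorem commute_psi (m n : ℕ) : Commute (gen q (Gen.psi m)) (gen q (Gen.psi n)) := by
  have := RingQuot.mkAlgHom_rel K (Rel.psi_psi (q := q) m n)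
  simpa only [map_mul, mkAlgHom_ι, commute_iff_eq] using this

theorem phi_mul_xp (m : ℕ) (l : ℤ) : gen q (Gen.phi m) * gen q (Gen.xp l) =
    ∑ p ∈ antidiagonal m, coeff p.1 (gSeries q) •
      (gen q Gen.gamInv ^ p.1 * gen q (Gen.xp (l + -1 * (p.1 : ℤ))) * gen q (Gen.phi p.2)) := by
  have := RingQuot.mkAlgHom_rel K (Rel.phi_xp (q := q) m l)
  simpa only [map_mul, exchangeCoeff, map_sum, twist, map_smul, mkAlgHom_gamPow_neg, mkAlgHom_ι,
    smul_mul_assoc] using this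

theorem psi_mul_xp (m : ℕ) (l : ℤ) : gen q (Gen.psi m) * gen q (Gen.xp l) =
    ∑ p ∈ antidiagonal m, coeff p.1 (gSeries q)⁻¹ •
      (gen q Gen.gamInv ^ p.1 * gen q (Gen.xp (l + 1 * (p.1 : ℤ))) * gen q (Gen.psi p.2)) := by
  have := RingQuot.mkAlgHom_rel K (Rel.psi_xp (q := q) m l)
  simpa only [map_mul, exchangeCoeff, map_sum, twist, map_smul, mkAlgHom_gamPow_neg, mkAlgHom_ι,
    smul_mul_assoc] using this

end Relations

/-! ### Structure functions and normalization of the modes -/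

section Factors

variable {q : K}

theorem gSeries_mul (hq0 : q ≠ 0) :
    gSeries q * (1 - C (q ^ 2)⁻¹ * X) = C (q ^ 2)⁻¹ * (1 - C (q ^ 2) * X) := by
  have h2 : q ^ 2 ≠ 0 := pow_ne_zero 2 hq0
  have h : (X - C (q ^ 2) : PowerSeries K)⁻¹ * (X - C (q ^ 2)) = 1 :=
    PowerSeries.inv_mul_cancel _ (by simpa using hq0)
  have hC : (C (q ^ 2)⁻¹ * C (q ^ 2) : PowerSeries K) = 1 := by
    rw [← map_mul, inv_mul_cancel₀ h2, map_one]
  rw [gSeries]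
  linear_combination -(C (q ^ 2)⁻¹ * (C (q ^ 2) * X - 1)) * h -
    (C (q ^ 2) * X - 1) * (X - C (q ^ 2))⁻¹ * hC

theorem gSeries_inv_mul (hq0 : q ≠ 0) :
    (gSeries q)⁻¹ * (1 - C (q ^ 2) * X) = C (q ^ 2) * (1 - C (q ^ 2)⁻¹ * X) := by
  have h2 : q ^ 2 ≠ 0 := pow_ne_zero 2 hq0
  have hg := gSeries_mul hq0
  have h0 : constantCoeff (gSeries q) ≠ 0 := by
    have := congrArg constantCoeff hg
    simp only [map_mul, map_sub, map_one, constantCoeff_C, constantCoeff_X, mul_zero, sub_zero,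
      mul_one] at this
    rw [this]
    exact inv_ne_zero h2
  have hC : (C (q ^ 2) * C (q ^ 2)⁻¹ : PowerSeries K) = 1 := by
    rw [← map_mul, mul_inv_cancel₀ h2, map_one]
  have h := PowerSeries.inv_mul_cancel _ h0
  linear_combination C (q ^ 2) * (1 - C (q ^ 2)⁻¹ * X) * h - C (q ^ 2) * (gSeries q)⁻¹ * hg -
    (gSeries q)⁻¹ * (1 - C (q ^ 2) * X) * hC

theorem factorMinus_mul : factorMinus q * (1 - C 1 * X) = 1 - C (q ^ 2) * X := by
  have h : (1 - X : PowerSeries K)⁻¹ * (1 - X) = 1 := PowerSeries.inv_mul_cancel _ (by simp)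
  rw [factorMinus, map_one, one_mul, mul_assoc, h, mul_one]

theorem factorPlus_mul : factorPlus q * (1 - C (q ^ 2) * X) = 1 - C 1 * X := by
  have h : (C (q ^ 2) * X - 1 : PowerSeries K)⁻¹ * (C (q ^ 2) * X - 1) = 1 :=
    PowerSeries.inv_mul_cancel _ (by simp)
  rw [factorPlus, map_one]
  linear_combination -(X - 1) * h

theorem sub_inv_ne_zero (hq0 : q ≠ 0) (hq : ∀ n : ℕ, 0 < n → q ^ n ≠ 1) : q - q⁻¹ ≠ 0 := by
  intro h
  refine hq 2 two_pos ?_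
  field_simp at h
  linear_combination h

/-- If `q^{2n} = -1` then `q^{4n} = 1`. -/
theorem one_add_pow_ne_zero (hq : ∀ n : ℕ, 0 < n → q ^ n ≠ 1) {n : ℕ} (hn : 0 < n) :
    1 + q ^ (2 * n) ≠ 0 := by
  intro h
  refine hq (2 * (2 * n)) (by omega) ?_
  rw [two_mul (2 * n), pow_add]
  linear_combination (q ^ (2 * n) - 1) * h

theorem kMinus_eq (hq0 : q ≠ 0) (hq : ∀ n : ℕ, 0 < n → q ^ n ≠ 1) :
    kMinus q = expSeries K (PowerSeries.mk fun n => if n = 0 then 0 else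
      (-(q ^ (2 * n) / (1 + q ^ (2 * n)))) • (gen q Gen.gam ^ n * coeff n
        (logSeries K ((PowerSeries.mk fun m => gen q (Gen.psi m)) * C (gen q (Gen.phi 0)))))) := by
  rw [kMinus]
  congr 2
  funext n
  split_ifs with hn
  · rfl
  · rw [a, if_pos (by omega), Int.toNat_natCast, mul_smul_comm, smul_smul, mul_right_comm,
      mul_inv_cancel₀ (sub_inv_ne_zero hq0 hq), one_mul, psiSeries]

/-- The sign in the exponent cancels the one defining `a_{-n}`, leaving the same multipliers as for
`kMinus`. -/
theorem kPlus_eq (hq0 : q ≠ 0) (hq : ∀ n : ℕ, 0 < n → q ^ n ≠ 1) :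
    kPlus q = expSeries K (PowerSeries.mk fun n => if n = 0 then 0 else
      (-(q ^ (2 * n) / (1 + q ^ (2 * n)))) • (gen q Gen.gam ^ n * coeff n
        (logSeries K ((PowerSeries.mk fun m => gen q (Gen.phi m)) * C (gen q (Gen.psi 0)))))) := by
  rw [kPlus]
  congr 2
  funext n
  split_ifs with hn
  · rfl
  · rw [a, if_neg (by omega), neg_neg, Int.toNat_natCast, mul_neg (gen q Gen.gam ^ n), mul_smul_comm,
      smul_neg, smul_smul, ← neg_smul, mul_right_comm, ← neg_mul, ← neg_mul,
      neg_neg, mul_inv_cancel₀ (sub_inv_ne_zero hq0 hq), one_mul, phiSeries]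

end Factors

end QAffine

end

/-! ### Application to `ψ` and `φ` -/

theorem mainTheorem11 {K : Type*} [Field K] [CharZero K] (q : K) (hq0 : q ≠ 0)
    (hq : ∀ n : ℕ, 0 < n → q ^ n ≠ 1) :
    -- the current `k^-(z)`, a series in `z⁻¹`
    (PowerSeries.coeff 0 (QAffine.kMinus q) = 1 ∧
      (∀ n : ℕ, PowerSeries.coeff n (QAffine.kMinus q) ∈ QAffine.homogeneous q (n : ℤ)) ∧
      (∀ m n : ℕ, Commute (PowerSeries.coeff m (QAffine.kMinus q))
        (PowerSeries.coeff n (QAffine.kMinus q))) ∧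
      -- `k^-(z) x^+(w) = ((z - w q²) / (z - w)) x^+(w) k^-(z)`
      (∀ (m : ℕ) (l : ℤ),
        PowerSeries.coeff m (QAffine.kMinus q) * QAffine.gen q (QAffine.Gen.xp l) =
          QAffine.exchangeCoeff 1
            (fun j => algebraMap K (QAffine.Uq q) (PowerSeries.coeff j (QAffine.factorMinus q)))
            (fun i => QAffine.gen q (QAffine.Gen.xp i))
            (fun i => PowerSeries.coeff i (QAffine.kMinus q)) m l)) ∧
    -- the current `k^+(z)`, a series in `z`
    (PowerSeries.coeff 0 (QAffine.kPlus q) = 1 ∧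
      (∀ n : ℕ, PowerSeries.coeff n (QAffine.kPlus q) ∈ QAffine.homogeneous q (-(n : ℤ))) ∧
      (∀ m n : ℕ, Commute (PowerSeries.coeff m (QAffine.kPlus q))
        (PowerSeries.coeff n (QAffine.kPlus q))) ∧
      -- `k^+(z) x^+(w) = ((z - w) / (z q² - w)) x^+(w) k^+(z)`
      (∀ (m : ℕ) (l : ℤ),
        PowerSeries.coeff m (QAffine.kPlus q) * QAffine.gen q (QAffine.Gen.xp l) =
          QAffine.exchangeCoeff (-1)
            (fun j => algebraMap K (QAffine.Uq q) (PowerSeries.coeff j (QAffine.factorPlus q)))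
            (fun i => QAffine.gen q (QAffine.Gen.xp i))
            (fun i => PowerSeries.coeff i (QAffine.kPlus q)) m l)) := by
  have h2 : q ^ 2 ≠ 0 := pow_ne_zero 2 hq0
  have hr (n : ℕ) (hn : 0 < n) : -(q ^ (2 * n) / (1 + q ^ (2 * n))) *
      ((q ^ 2) ^ n - ((q ^ 2)⁻¹) ^ n) = 1 ^ n - (q ^ 2) ^ n := by
    have := QAffine.one_add_pow_ne_zero hq hn
    rw [pow_mul] at this ⊢
    have h0 : (q ^ 2) ^ n ≠ 0 := pow_ne_zero n h2
    rw [inv_pow, one_pow]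
    field_simp
    ring
  have hm := QAffine.exp_smul_log_current (s := 1) (x := fun i => QAffine.gen q (QAffine.Gen.xp i))
    (ψ := fun i => QAffine.gen q (QAffine.Gen.psi i)) (QAffine.commute_psi q)
    (QAffine.phi_zero_mul_psi_zero q) (QAffine.psi_zero_mul_phi_zero q)
    (QAffine.gam_mul_gamInv q) (fun _ => QAffine.commute_gam q _) (QAffine.commute_gam q _)
    (fun _ => QAffine.commute_gam q _) h2 (QAffine.gSeries_inv_mul hq0) QAffine.factorMinus_mul
    (QAffine.psi_mul_xp q) hr (QAffine.kMinus_eq hq0 hq)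
  have hp := QAffine.exp_smul_log_current (s := -1) (x := fun i => QAffine.gen q (QAffine.Gen.xp i))
    (ψ := fun i => QAffine.gen q (QAffine.Gen.phi i)) (QAffine.commute_phi q)
    (QAffine.psi_zero_mul_phi_zero q) (QAffine.phi_zero_mul_psi_zero q)
    (QAffine.gam_mul_gamInv q) (fun _ => QAffine.commute_gam q _) (QAffine.commute_gam q _)
    (fun _ => QAffine.commute_gam q _) (inv_ne_zero h2) (QAffine.gSeries_mul hq0)
    QAffine.factorPlus_mul (QAffine.phi_mul_xp q)
    -- Passing from `ψ` to `φ` swaps `α` with `β` and `α'` with `β'`, so both sides of `hr` change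
    -- sign.
    (fun n hn => by linear_combination -hr n hn) (QAffine.kPlus_eq hq0 hq)
  refine ⟨⟨hm.1, fun n => ?_, hm.2⟩, hp.1, fun n => ?_, hp.2⟩
  · rw [QAffine.kMinus_eq hq0 hq, ← one_mul (n : ℤ)]
    exact QAffine.isGradedSeries_exp_smul_log
      (fun m => by simpa [QAffine.Gen.degree] using
        QAffine.gen_mem_homogeneous (q := q) (QAffine.Gen.psi m))
      (by simpa [QAffine.Gen.degree] using
        QAffine.gen_mem_homogeneous (q := q) (QAffine.Gen.phi 0)) _ n
  · rw [QAffine.kPlus_eq hq0 hq, ← neg_one_mul (n : ℤ)]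
    exact QAffine.isGradedSeries_exp_smul_log
      (fun m => by simpa [QAffine.Gen.degree] using
        QAffine.gen_mem_homogeneous (q := q) (QAffine.Gen.phi m))
      (by simpa [QAffine.Gen.degree] using
        QAffine.gen_mem_homogeneous (q := q) (QAffine.Gen.psi 0)) _ n
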